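/- Let $G$ be a locally compact Hausdorff topological group. A $G$-flow is a compact Hausdorff space $X$ with a jointly continuous action $G\curvearrowright X$; a $G$-map is a continuous $G$-equivariant map between flows. An irreducible extension of $X$ is a surjective $G$-map $\rho\colon Y\to X$ from a $G$-flow $Y$ such that every non-empty open $U\subseteq Y$ contains a fibre $\rho^{-1}(\{x\})$ for some $x\in X$. The universal irreducible extension $\pi\colon\hat X_G\to X$ is the irreducible extension, unique up to isomorphism, such that for every irreducible extension $\rho\colon Y\to X$ there is a $G$-map $p\colon\hat X_G\to Y$ with $\rho\circ p=\pi$. Let $\mathrm{Sub}(G)$ be the set of closed subgroups of $G$ with the Chabauty topology, generated by the sets $\{H: H\cap K=\emptyset\}$ ($K\subseteq G$ compact) and $\{H: H\cap U\neq\emptyset\}$ ($U\subseteq G$ open). For a $G$-flow $X$, let $\mathrm{Stab}\colon X\to\mathrm{Sub}(G)$, $x\mapsto G_x$, be the stabilizer map, and let $\mathrm S_G(X)=\{G_z: z\in\hat X_G\}\subseteq\mathrm{Sub}(G)$. Proposition 5.2. Let $X$ be a $G$-flow and let $\pi\colon\hat X_G\to X$ be its universal irreducible extension. Then: (i) for every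 compact $K\subseteq G$, the set $D_K=\{z\in\hat X_G: z\notin K\cdot z\text{ and }\pi(z)\in K\cdot\pi(z)\}$ is nowhere dense in $\hat X_G$; (ii) for every dense subset $X'\subseteq X$, $\mathrm S_G(X)\subseteq\overline{\mathrm{Stab}(X')}$; (iii) if $x\in X$ is a point of continuity of $\mathrm{Stab}$, then $G_x\in\mathrm S_G(X)$; (iv) if the set $X_0\subseteq X$ of continuity points of $\mathrm{Stab}$ is dense in $X$, then $\mathrm S_G(X)=\overline{\mathrm{Stab}(X_0)}$. -/

import Mathlib

open Set Topology TopologicalSpace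

universe u v w

/-! ## Flows and irreducible extensions

A `G`-flow is a compact Hausdorff space `X` with a jointly continuous action of `G`, that is,
a type with `[TopologicalSpace X] [CompactSpace X] [T2Space X] [MulAction G X] [ContinuousSMul G X]`.
-/

/-- `π` is irreducible: every nonempty open set contains a full fibre. -/
def IsIrreducibleMap {Y : Type w} {X : Type u} [TopologicalSpace Y] (π : Y → X) : Prop :=
  ∀ U : Set Y, IsOpen U → U.Nonempty → ∃ x : X, π ⁻¹' {x} ⊆ U

/-- A `G`-map: a continuous equivariant map. -/
structure IsGMap (G : Type v) {Y : Type w} {X : Type u} [TopologicalSpace Y] [TopologicalSpace X]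
    [SMul G Y] [SMul G X] (π : Y → X) : Prop where
  continuous : Continuous π
  map_smul : ∀ (g : G) (y : Y), π (g • y) = g • π y

/-- `π : Y → X` is an irreducible extension of `G`-flows: a surjective irreducible `G`-map. -/
structure IsIrreducibleExtension (G : Type v) {Y : Type w} {X : Type u} [TopologicalSpace Y]
    [TopologicalSpace X] [SMul G Y] [SMul G X] (π : Y → X) : Prop extends IsGMap G π where
  surjective : Function.Surjective π
  irreducible : IsIrreducibleMap π

/-- `π : Z → X` is the universal irreducible extension of the `G`-flow `X` (it is unique up to
isomorphism): it is an irreducible extension which factors through every irreducible extension.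
Letting `Y` range over the universe of `X` loses nothing, since the points of an irreducible
extension of `X` are separated by families of subsets of `X`; see
`IsUniversalIrreducibleExtension.exists_factorization` below. -/
structure IsUniversalIrreducibleExtension (G : Type v) [Group G] [TopologicalSpace G] {Z X : Type u}
    [TopologicalSpace Z] [TopologicalSpace X] [MulAction G Z] [MulAction G X] (π : Z → X) : Prop
    extends IsIrreducibleExtension G π where
  universal : ∀ (Y : Type u) [TopologicalSpace Y] [CompactSpace Y] [T2Space Y] [MulAction G Y]
    [ContinuousSMul G Y] (ρ : Y → X), IsIrreducibleExtension G ρ →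
      ∃ p : Z → Y, IsGMap G p ∧ ρ ∘ p = π

/-! ## The space of closed subgroups and the stabilizer map -/

/-- The Chabauty topology on the closed subsets of `Y`. -/
@[reducible] def chabautyTopology (Y : Type v) [TopologicalSpace Y] : TopologicalSpace (Closeds Y) :=
  generateFrom
    ({A | ∃ K : Set Y, IsCompact K ∧ A = {F : Closeds Y | (F : Set Y) ∩ K = ∅}} ∪
     {A | ∃ U : Set Y, IsOpen U ∧ A = {F : Closeds Y | ((F : Set Y) ∩ U).Nonempty}})

/-- `Sub(G)`, the closed subgroups of `G`, as a subspace of the closed subsets of `G` with the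
Chabauty topology. -/
instance chabautySub (G : Type v) [Group G] [TopologicalSpace G] :
    TopologicalSpace (ClosedSubgroup G) :=
  (chabautyTopology G).induced fun H => ⟨(H : Set G), H.isClosed'⟩

/-- The stabilizer map `x ↦ G_x` of a flow. -/
def stabilizerMap (G : Type v) (X : Type u) [Group G] [TopologicalSpace G] [TopologicalSpace X]
    [T2Space X] [MulAction G X] [ContinuousSMul G X] (x : X) : ClosedSubgroup G where
  toSubgroup := MulAction.stabilizer G x
  isClosed' := isClosed_eq (by fun_prop) continuous_const

/-- The stabilizer flow `S_G(X)`: the image of the stabilizer map of the universal irreducible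
extension `π : Z → X` of `X`. -/
def stabilizerFlow {G : Type v} {Z X : Type u} [Group G] [TopologicalSpace G]
    [TopologicalSpace Z] [T2Space Z] [MulAction G Z] [ContinuousSMul G Z]
    [TopologicalSpace X] [MulAction G X] {π : Z → X}
    (_hπ : IsUniversalIrreducibleExtension G π) : Set (ClosedSubgroup G) :=
  range (stabilizerMap G Z)

/-! ## Existence of the universal irreducible extension -/

namespace IrreducibleExtension

/-- The set of points whose whole fibre lies in `U`. -/
def fiberImage {Y : Type w} {X : Type u} (π : Y → X) (U : Set Y) : Set X :=
  {x | π ⁻¹' {x} ⊆ U}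

theorem isOpen_fiberImage {Y : Type w} {X : Type u} [TopologicalSpace Y] [TopologicalSpace X]
    [CompactSpace Y] [T2Space X] {π : Y → X} (hπ : Continuous π) {U : Set Y} (hU : IsOpen U) :
    IsOpen (fiberImage π U) := by
  have h : fiberImage π U = (π '' Uᶜ)ᶜ := by
    ext x
    simp only [fiberImage, mem_ofPred_eq, subset_def, mem_preimage, mem_singleton_iff, mem_compl_iff,
      mem_image, not_exists, not_and]
    exact ⟨fun h y hy e => hy (h y e), fun h y e => by_contra fun hy => h y hy e⟩
  rw [h, isOpen_compl_iff]
  exact hπ.isClosedMap _ hU.isClosed_compl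

/-- Two maps between irreducible extensions which lie over the same bijection of the base agree. -/
theorem map_unique {Y : Type w} {Y' : Type*} {X : Type u} [TopologicalSpace Y]
    [CompactSpace Y] [TopologicalSpace Y'] [T2Space Y'] {ρ : Y → X} {ρ' : Y' → X}
    (hs : Function.Surjective ρ) (hi : IsIrreducibleMap ρ) (hi' : IsIrreducibleMap ρ')
    {σ : X → X} (hσ : Function.Bijective σ) {f g : Y → Y'} (hf : Continuous f) (hg : Continuous g)
    (hfσ : ∀ y, ρ' (f y) = σ (ρ y)) (hgσ : ∀ y, ρ' (g y) = σ (ρ y)) : f = g := by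
  have surj : ∀ k : Y → Y', Continuous k → (∀ y, ρ' (k y) = σ (ρ y)) → Function.Surjective k := by
    intro k hk hkσ y'
    by_contra hy
    obtain ⟨x, hx⟩ := hi' (range k)ᶜ (isCompact_range hk).isClosed.isOpen_compl ⟨y', hy⟩
    obtain ⟨x₀, rfl⟩ := hσ.2 x
    obtain ⟨y, rfl⟩ := hs x₀
    exact hx (show k y ∈ _ from hkσ y) ⟨y, rfl⟩
  funext y
  by_contra hne
  obtain ⟨U, V, hU, hV, hyU, hyV, hd⟩ := t2_separation hne
  obtain ⟨x, hx⟩ := hi (f ⁻¹' U ∩ g ⁻¹' V) ((hU.preimage hf).inter (hV.preimage hg)) ⟨y, hyU, hyV⟩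
  obtain ⟨y₀, rfl⟩ := hs x
  have h1 : f y₀ ∈ U := (hx rfl).1
  obtain ⟨y₁, hy₁⟩ := surj g hg hgσ (f y₀)
  have h2 : ρ y₁ = ρ y₀ := hσ.1 (by rw [← hgσ, ← hfσ, hy₁])
  have h3 : g y₁ ∈ V := (hx h2).2
  exact disjoint_left.1 hd h1 (hy₁ ▸ h3)

/-- The open fibre images at a point determine the point of an irreducible extension. -/
def trace {Y : Type w} {X : Type u} [TopologicalSpace Y] (π : Y → X) (y : Y) : Set (Set X) :=
  {A | ∃ U : Set Y, IsOpen U ∧ y ∈ U ∧ fiberImage π U = A}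

theorem trace_injective {Y : Type w} {X : Type u} [TopologicalSpace Y] [T2Space Y] {π : Y → X}
    (hs : Function.Surjective π) (hi : IsIrreducibleMap π) : Function.Injective (trace π) := by
  intro y y' h
  by_contra hne
  obtain ⟨U, V, hU, hV, hyU, hyV, hd⟩ := t2_separation hne
  have h1 : fiberImage π U ∈ trace π y' := h ▸ ⟨U, hU, hyU, rfl⟩
  obtain ⟨W, hW, hyW, e⟩ := h1
  obtain ⟨x, hx⟩ := hi (W ∩ V) (hW.inter hV) ⟨y', hyW, hyV⟩
  obtain ⟨z, rfl⟩ := hs x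
  have h2 : π z ∈ fiberImage π U := by
    rw [← e]; exact fun t ht => (hx ht).1
  exact disjoint_left.1 hd (h2 rfl) (hx rfl).2

/-- Irreducible extensions of `X` carried by a set of families of subsets of `X`. -/
structure SmallExt (G : Type v) (X : Type u) [Group G] [TopologicalSpace G] [TopologicalSpace X]
    [MulAction G X] : Type u where
  carrier : Set (Set (Set X))
  top : TopologicalSpace carrier
  map : carrier → X
  ext : ∃ _ : MulAction G carrier, CompactSpace carrier ∧ T2Space carrier ∧
    ContinuousSMul G carrier ∧ IsIrreducibleExtension G map

section
variable {G : Type v} {X : Type u} [Group G] [TopologicalSpace G] [TopologicalSpace X]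
    [MulAction G X]

instance (i : SmallExt G X) : TopologicalSpace i.carrier := i.top
noncomputable instance instMulActionCarrier (i : SmallExt G X) : MulAction G i.carrier := i.ext.choose
instance (i : SmallExt G X) : CompactSpace i.carrier := i.ext.choose_spec.1
instance (i : SmallExt G X) : T2Space i.carrier := i.ext.choose_spec.2.1
instance (i : SmallExt G X) : ContinuousSMul G i.carrier := i.ext.choose_spec.2.2.1
theorem SmallExt.isExt (i : SmallExt G X) : IsIrreducibleExtension G i.map := i.ext.choose_spec.2.2.2

/-- A homeomorphism over `X` between irreducible extensions is equivariant. -/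
theorem map_smul_of_comp_eq {Y : Type w} [TopologicalSpace Y] [CompactSpace Y]
    [T2Space Y] [MulAction G Y] [ContinuousSMul G Y] {ρ : Y → X} (hρ : IsIrreducibleExtension G ρ)
    (i : SmallExt G X) (h : i.carrier → Y) (hc : Continuous h) (hh : ρ ∘ h = i.map) (g : G)
    (s : i.carrier) : h (g • s) = g • h s := by
  have hh' : ∀ t, ρ (h t) = i.map t := congrFun hh
  exact congrFun (map_unique (f := fun s => h (g • s)) (g := fun s => g • h s) (σ := fun x => g • x)
    i.isExt.surjective i.isExt.irreducible hρ.irreducible (MulAction.bijective g)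
    (hc.comp (continuous_const_smul g)) (hc.const_smul g)
    (fun t => by rw [hh', i.isExt.map_smul]) (fun t => by rw [hρ.map_smul, hh'])) s

theorem exists_small_of_homeomorph {Y : Type w} [TopologicalSpace Y] [CompactSpace Y]
    [T2Space Y] [MulAction G Y] [ContinuousSMul G Y] {ρ : Y → X} (hρ : IsIrreducibleExtension G ρ)
    (S : Set (Set (Set X))) [τ : TopologicalSpace S] (h : S ≃ₜ Y) :
    ∃ (i : SmallExt G X) (q : i.carrier → Y), IsGMap G q ∧ ρ ∘ q = i.map := by
  have hext : ∃ _ : MulAction G S, CompactSpace S ∧ T2Space S ∧ ContinuousSMul G S ∧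
      IsIrreducibleExtension G (ρ ∘ h) := by
    let α : MulAction G S := h.toEquiv.mulAction G
    have hα : ∀ (g : G) (s : S), h (g • s) = g • h s := fun g s => h.apply_symm_apply _
    refine ⟨α, h.symm.compactSpace, h.symm.t2Space, ⟨?_⟩, ?_⟩
    · rw [← h.comp_continuous_iff]
      have : h ∘ (fun p : G × S => p.1 • p.2) = fun p => p.1 • h p.2 := funext fun p => hα _ _
      rw [this]
      exact continuous_fst.smul (h.continuous.comp continuous_snd)
    · refine ⟨⟨hρ.continuous.comp h.continuous, fun g y => ?_⟩, hρ.surjective.comp h.surjective, ?_⟩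
      · simp only [Function.comp_apply, hα, hρ.map_smul]
      · intro U hU hne
        obtain ⟨x, hx⟩ := hρ.irreducible (h '' U) (h.isOpenMap _ hU) (hne.image _)
        refine ⟨x, fun s hs => ?_⟩
        obtain ⟨t, ht, hts⟩ := hx (show h s ∈ _ from hs)
        exact h.injective hts ▸ ht
  obtain ⟨i, q, hq, hqi⟩ : ∃ (i : SmallExt G X) (q : i.carrier → Y), Continuous q ∧ ρ ∘ q = i.map :=
    ⟨⟨S, τ, ρ ∘ h, hext⟩, h, h.continuous, rfl⟩
  exact ⟨i, q, ⟨hq, map_smul_of_comp_eq hρ i q hq hqi⟩, hqi⟩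

/-- Every irreducible extension is isomorphic to a small one. -/
theorem exists_small (Y : Type w) [TopologicalSpace Y] [CompactSpace Y]
    [T2Space Y] [MulAction G Y] [ContinuousSMul G Y] {ρ : Y → X} (hρ : IsIrreducibleExtension G ρ) :
    ∃ (i : SmallExt G X) (q : i.carrier → Y), IsGMap G q ∧ ρ ∘ q = i.map :=
  let e : Y ≃ range (trace ρ) := Equiv.ofInjective _ (trace_injective hρ.surjective hρ.irreducible)
  letI : TopologicalSpace (range (trace ρ)) := .induced e.symm inferInstance
  exists_small_of_homeomorph hρ (range (trace ρ)) (e.symm.toHomeomorphOfIsInducing ⟨rfl⟩)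

/-- The fibre product over `X` of all small irreducible extensions. -/
def fiberProduct (G : Type v) (X : Type u) [Group G] [TopologicalSpace G] [TopologicalSpace X]
    [MulAction G X] (i₀ : SmallExt G X) : Set (∀ i : SmallExt G X, i.carrier) :=
  {z | ∀ i : SmallExt G X, i.map (z i) = i₀.map (z i₀)}

/-- The points all of whose neighbourhoods in the fibre product contain a full fibre. -/
def core (i₀ : SmallExt G X) : Set (∀ i : SmallExt G X, i.carrier) :=
  {z | z ∈ fiberProduct G X i₀ ∧ ∀ N, IsOpen N → z ∈ N →
    ∃ x : X, ∀ t ∈ fiberProduct G X i₀, i₀.map (t i₀) = x → t ∈ N}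

theorem isClosed_fiberProduct [T2Space X] (i₀ : SmallExt G X) :
    IsClosed (fiberProduct G X i₀) := by
  have : fiberProduct G X i₀ = ⋂ i : SmallExt G X, {z | i.map (z i) = i₀.map (z i₀)} := by
    ext z; simp [fiberProduct]
  rw [this]
  exact isClosed_iInter fun i => isClosed_eq (i.isExt.continuous.comp (continuous_apply i))
    (i₀.isExt.continuous.comp (continuous_apply i₀))

theorem isClosed_core [T2Space X] (i₀ : SmallExt G X) : IsClosed (core i₀) := by
  have : core i₀ = fiberProduct G X i₀ ∩ (⋃₀ {N | IsOpen N ∧ ¬ ∃ x : X,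
      ∀ t ∈ fiberProduct G X i₀, i₀.map (t i₀) = x → t ∈ N})ᶜ := by
    ext z
    simp only [core, mem_ofPred_eq, mem_inter_iff, mem_compl_iff, mem_sUnion, not_exists, not_and]
    refine and_congr_right fun _ => ⟨fun h N hN hz => ?_, fun h N hN hz => ?_⟩
    · obtain ⟨x, hx⟩ := h N hN.1 hz
      exact hN.2 x hx
    · by_contra hne
      exact h N ⟨hN, fun x hx => hne ⟨x, hx⟩⟩ hz
  rw [this]
  exact (isClosed_fiberProduct i₀).inter (isOpen_sUnion fun N hN => hN.1).isClosed_compl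

theorem smul_mem_fiberProduct (i₀ : SmallExt G X) (g : G) {z : ∀ i : SmallExt G X, i.carrier}
    (hz : z ∈ fiberProduct G X i₀) : g • z ∈ fiberProduct G X i₀ := fun i => by
  simp only [Pi.smul_apply, i.isExt.map_smul, i₀.isExt.map_smul, hz i]

theorem smul_mem_core (i₀ : SmallExt G X) (g : G) {z : ∀ i : SmallExt G X, i.carrier}
    (hz : z ∈ core i₀) : g • z ∈ core i₀ := by
  refine ⟨smul_mem_fiberProduct i₀ g hz.1, fun N hN hzN => ?_⟩
  obtain ⟨x, hx⟩ := hz.2 ((fun t => g • t) ⁻¹' N) (hN.preimage (continuous_const_smul g)) hzN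
  refine ⟨g • x, fun t ht htx => ?_⟩
  have := hx (g⁻¹ • t) (smul_mem_fiberProduct i₀ _ ht) (by
    simp [i₀.isExt.map_smul, htx])
  simpa using this

theorem exists_mem_core [T2Space X] (i₀ : SmallExt G X) (x : X) :
    ∃ z ∈ core i₀, i₀.map (z i₀) = x := by
  let P := fiberProduct G X i₀
  have : CompactSpace P := isCompact_iff_compactSpace.1 (isClosed_fiberProduct i₀).isCompact
  let π : P → X := fun z => i₀.map (z.1 i₀)
  have hπ : Continuous π :=
    i₀.isExt.continuous.comp ((continuous_apply i₀).comp continuous_subtype_val)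
  have hs : Function.Surjective π := fun x => by
    choose y hy using fun i : SmallExt G X => i.isExt.surjective x
    exact ⟨⟨y, fun i => (hy i).trans (hy i₀).symm⟩, hy i₀⟩
  obtain ⟨M, hMc, hMs, hMm⟩ := exists_compact_surjective_zorn_subset hπ hs
  obtain ⟨m, hm, rfl⟩ : x ∈ π '' M := hMs ▸ mem_univ x
  refine ⟨m.1, ⟨m.2, fun N hN hmN => ?_⟩, rfl⟩
  obtain ⟨F, U, hU, hUN⟩ := isOpen_pi_iff.1 hN m.1 hmN
  -- an open set of base points over which `M` lies in the basic neighbourhood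
  let B : Set (∀ i : SmallExt G X, i.carrier) := (F : Set (SmallExt G X)).pi U
  have hB : IsOpen B := isOpen_set_pi F.finite_toSet fun i hi => (hU i hi).1
  have hMcl : IsClosed (M ∩ (Subtype.val ⁻¹' B)ᶜ) :=
    (isCompact_iff_compactSpace.2 hMc).isClosed.inter (hB.preimage continuous_subtype_val).isClosed_compl
  let W : Set X := (π '' (M ∩ (Subtype.val ⁻¹' B)ᶜ))ᶜ
  have hW : IsOpen W := (hπ.isClosedMap _ hMcl).isOpen_compl
  have hWB : ∀ z ∈ M, π z ∈ W → z.1 ∈ B := fun z hz hzW => by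
    by_contra hne
    exact hzW ⟨z, ⟨hz, hne⟩, rfl⟩
  have hWne : W.Nonempty := by
    rw [nonempty_compl]
    intro huniv
    have hsub : M ∩ (Subtype.val ⁻¹' B)ᶜ = M := by
      by_contra hne
      let E₀ : Set M := Subtype.val ⁻¹' (M ∩ (Subtype.val ⁻¹' B)ᶜ)
      have hE₀ : E₀ ≠ univ := fun h => hne (inter_eq_left.2 fun z hz => by
        have : (⟨z, hz⟩ : M) ∈ E₀ := h ▸ mem_univ _
        exact this.2)
      refine hMm E₀ hE₀ (hMcl.preimage continuous_subtype_val) ?_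
      rw [← huniv]
      ext y
      constructor
      · rintro ⟨z, hz, rfl⟩
        exact ⟨z.1, hz, rfl⟩
      · rintro ⟨z, hz, rfl⟩
        exact ⟨⟨z, hz.1⟩, hz, rfl⟩
    have : m ∈ M ∩ (Subtype.val ⁻¹' B)ᶜ := hsub.symm.subset hm
    exact this.2 fun i hi => (hU i hi).2
  have main : ∀ F' : Finset (SmallExt G X), F' ⊆ F → ∃ V : Set X, IsOpen V ∧ V.Nonempty ∧ V ⊆ W ∧
      ∀ y ∈ V, ∀ i ∈ F', i.map ⁻¹' {y} ⊆ U i := by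
    classical
    intro F'
    induction F' using Finset.induction_on with
    | empty => exact fun _ => ⟨W, hW, hWne, Subset.rfl, by simp⟩
    | insert j F' _ ih =>
      intro hF
      obtain ⟨V, hV, ⟨y, hy⟩, hVW, hVF⟩ := ih ((Finset.subset_insert _ _).trans hF)
      have hj := hF (Finset.mem_insert_self j F')
      have hO : IsOpen (j.map ⁻¹' V ∩ U j) := (hV.preimage j.isExt.continuous).inter (hU j hj).1
      obtain ⟨z, hz, hzy⟩ : y ∈ π '' M := hMs ▸ mem_univ y
      have hne : (j.map ⁻¹' V ∩ U j).Nonempty := by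
        refine ⟨z.1 j, ?_, hWB z hz (hzy ▸ hVW hy) j hj⟩
        have : j.map (z.1 j) = y := (z.2 j).trans hzy
        simpa [this] using hy
      obtain ⟨y', hy'⟩ := j.isExt.irreducible _ hO hne
      have hsub : fiberImage j.map (j.map ⁻¹' V ∩ U j) ⊆ V := fun a ha => by
        obtain ⟨b, rfl⟩ := j.isExt.surjective a
        exact (ha rfl).1
      refine ⟨_, isOpen_fiberImage j.isExt.continuous hO, ⟨y', hy'⟩, hsub.trans hVW, ?_⟩
      intro a ha i hi
      rcases Finset.mem_insert.1 hi with rfl | hi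
      · exact fun b hb => (ha hb).2
      · exact hVF a (hsub ha) i hi
  obtain ⟨V, -, ⟨y, hy⟩, -, hVF⟩ := main F Finset.Subset.rfl
  exact ⟨y, fun t ht hty => hUN fun i hi => hVF y hy i hi ((ht i).trans hty)⟩

end

end IrreducibleExtension

open IrreducibleExtension in
/-- The universal property holds for irreducible extensions in every universe. -/
theorem IsUniversalIrreducibleExtension.exists_factorization {G : Type v} [Group G]
    [TopologicalSpace G] {Z X : Type u} [TopologicalSpace Z] [TopologicalSpace X] [MulAction G Z]
    [MulAction G X] {π : Z → X} (hπ : IsUniversalIrreducibleExtension G π)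
    (Y : Type w) [TopologicalSpace Y] [CompactSpace Y] [T2Space Y] [MulAction G Y]
    [ContinuousSMul G Y] (ρ : Y → X) (hρ : IsIrreducibleExtension G ρ) :
    ∃ p : Z → Y, IsGMap G p ∧ ρ ∘ p = π := by
  obtain ⟨i, q, hq, hqi⟩ := exists_small Y hρ
  obtain ⟨p, hp, hpi⟩ := hπ.universal i.carrier i.map i.isExt
  exact ⟨q ∘ p, ⟨hq.continuous.comp hp.continuous, fun g z => by
    simp only [Function.comp_apply, hp.map_smul, hq.map_smul]⟩, by
    rw [← Function.comp_assoc, hqi, hpi]⟩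

open IrreducibleExtension in
/-- Every `G`-flow has a universal irreducible extension. -/
theorem exists_isUniversalIrreducibleExtension (G : Type v) (X : Type u) [Group G]
    [TopologicalSpace G] [TopologicalSpace X] [CompactSpace X] [T2Space X] [MulAction G X]
    [ContinuousSMul G X] :
    ∃ (Z : Type u) (_ : TopologicalSpace Z) (_ : CompactSpace Z) (_ : T2Space Z)
      (_ : MulAction G Z) (_ : ContinuousSMul G Z) (π : Z → X),
      IsUniversalIrreducibleExtension G π := by
  have hid : IsIrreducibleExtension G (id : X → X) :=
    ⟨⟨continuous_id, fun _ _ => rfl⟩, Function.surjective_id, fun U _ ⟨x, hx⟩ =>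
      ⟨x, by simpa using hx⟩⟩
  obtain ⟨i₀, -⟩ := exists_small X hid
  let α : MulAction G (core i₀) :=
    { smul := fun g z => ⟨g • z.1, smul_mem_core i₀ g z.2⟩
      one_smul := fun z => Subtype.ext (one_smul G z.1)
      mul_smul := fun g h z => Subtype.ext (mul_smul g h z.1) }
  have hc : ContinuousSMul G (core i₀) :=
    ⟨(continuous_fst.smul (continuous_subtype_val.comp continuous_snd)).subtype_mk _⟩
  refine ⟨core i₀, inferInstance, isCompact_iff_compactSpace.1 (isClosed_core i₀).isCompact,
    inferInstance, α, hc, fun z => i₀.map (z.1 i₀), ?_⟩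
  refine ⟨⟨⟨?_, ?_⟩, ?_, ?_⟩, ?_⟩
  · exact i₀.isExt.continuous.comp ((continuous_apply i₀).comp continuous_subtype_val)
  · exact fun g z => i₀.isExt.map_smul g (z.1 i₀)
  · intro x
    obtain ⟨z, hz, hx⟩ := exists_mem_core i₀ x
    exact ⟨⟨z, hz⟩, hx⟩
  · rintro U hU ⟨z, hz⟩
    obtain ⟨N, hN, rfl⟩ := isOpen_induced_iff.1 hU
    obtain ⟨x, hx⟩ := z.2.2 N hN hz
    exact ⟨x, fun t ht => hx t.1 t.2.1 ht⟩
  · intro Y _ _ _ _ _ ρ hρ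
    obtain ⟨i, q, hq, hqi⟩ := exists_small Y hρ
    refine ⟨fun z => q (z.1 i),
      ⟨hq.continuous.comp ((continuous_apply i).comp continuous_subtype_val),
        fun g z => hq.map_smul g (z.1 i)⟩, ?_⟩
    funext z
    exact (congrFun hqi (z.1 i)).trans (z.2.1 i)

/-! The heart of the matter is that the stabilizer map of the universal irreducible extension `Z` is
continuous (`continuous_stabilizerMap`). Half of this, that a compact set missing a stabilizer
misses the nearby ones, holds in every flow. The other half says that if `g` fixes `z`, then every
point near `z` is fixed by an element near `g`.

It rests on a weak form of extremal disconnectedness, `disjoint_closure`: open sets `A` and `B`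
which no element of a neighbourhood of `1` connects have disjoint closures. Smearing the indicator
of `A` along orbits gives a bounded lower semicontinuous function, equicontinuous along orbits,
equal to `1` on `A` and `0` on `B`. Adjoining its orbit values to `Z` gives an irreducible extension
of `Z`. This extension splits by universality, and the section provides a continuous function
separating `A` from `B`. Now suppose that points not fixed near `g` accumulate at `z`. The colouring
`exists_finite_family_returns_small` cuts them, up to a nowhere dense set, into finitely many open
sets `B i`, each separated from `g • B i`. Some `closure (B i)` contains `z = g • z`, hence meets
`closure (g • B i)`, a contradiction.

Irreducibility makes the returns that exist in `X` but not in `Z` nowhere dense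
(`isNowhereDense_returns`). Hence the stabilizer of `π y` tends to that of `z` as `y` tends to `z`
along generic sets (`tendsto_stabilizerMap_comp`). The claims on closures and continuity points
follow, because `ClosedSubgroup G` is Hausdorff and `Z` is compact. -/

/-! ## The filter of generic sets -/

section GenericFilter

open Filter

/-- The filter generated by the dense open sets. -/
def genericFilter (Z : Type*) [TopologicalSpace Z] : Filter Z where
  sets := {s | Dense (interior s)}
  univ_sets := by
    change Dense (interior univ)
    simp
  sets_of_superset h hst := Dense.mono (interior_mono hst) h
  inter_sets {s t} hs ht := by
    change Dense (interior (s ∩ t))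
    rw [interior_inter]
    exact Dense.inter_of_isOpen_left hs ht isOpen_interior

variable {Z : Type*} [TopologicalSpace Z]

theorem mem_genericFilter {s : Set Z} : s ∈ genericFilter Z ↔ Dense (interior s) := Iff.rfl

theorem exists_isOpen_subset_of_mem_nhds_inf_genericFilter {z : Z} {s : Set Z}
    (hs : s ∈ 𝓝 z ⊓ genericFilter Z) : ∃ O : Set Z, IsOpen O ∧ O.Nonempty ∧ O ⊆ s := by
  obtain ⟨N, hN, D, hD, rfl⟩ := mem_inf_iff.1 hs
  refine ⟨interior N ∩ interior D, isOpen_interior.inter isOpen_interior, ?_,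
    inter_subset_inter interior_subset interior_subset⟩
  exact Dense.inter_open_nonempty hD _ isOpen_interior ⟨z, mem_interior_iff_mem_nhds.2 hN⟩

theorem IsNowhereDense.compl_mem_genericFilter {s : Set Z} (hs : IsNowhereDense s) :
    sᶜ ∈ genericFilter Z := by
  rw [mem_genericFilter, interior_compl]
  exact interior_eq_empty_iff_dense_compl.1 hs

/-- This makes generic limits at `z` unique and provides ultrafilters of generic sets converging to
`z`. -/
instance nhds_inf_genericFilter_neBot (z : Z) : (𝓝 z ⊓ genericFilter Z).NeBot := by
  refine ⟨fun h => ?_⟩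
  obtain ⟨O, -, ⟨y, hy⟩, hO⟩ :=
    exists_isOpen_subset_of_mem_nhds_inf_genericFilter (z := z) (s := ∅) (by rw [h]; trivial)
  exact hO hy

end GenericFilter

/-! ## Compact sets of returns -/

/-- Projection along a compact factor is a closed map. -/
theorem IsCompact.isClosed_setOf_exists_eq {P T Z : Type*} [TopologicalSpace P]
    [TopologicalSpace T] [TopologicalSpace Z] [T2Space Z] {K : Set P} (hK : IsCompact K)
    {f g : P × T → Z} (hf : Continuous f) (hg : Continuous g) :
    IsClosed {t | ∃ k ∈ K, f (k, t) = g (k, t)} := by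
  have : CompactSpace K := isCompact_iff_compactSpace.1 hK
  have h : {t | ∃ k ∈ K, f (k, t) = g (k, t)} =
      Prod.snd '' {p : K × T | f (p.1, p.2) = g (p.1, p.2)} := by
    ext t
    constructor
    · rintro ⟨k, hk, e⟩
      exact ⟨(⟨k, hk⟩, t), e, rfl⟩
    · rintro ⟨⟨k, t⟩, e, rfl⟩
      exact ⟨k, k.2, e⟩
  rw [h]
  exact isClosedMap_snd_of_compactSpace _ (isClosed_eq (by fun_prop) (by fun_prop))

section Returns

variable {G : Type*} [Group G] [TopologicalSpace G] {Z : Type*} [TopologicalSpace Z] [T2Space Z]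
  [MulAction G Z] [ContinuousSMul G Z]

theorem isClosed_setOf_exists_smul_eq {K : Set G} (hK : IsCompact K) (q : G) :
    IsClosed {z : Z | ∃ k ∈ K, k • z = q • z} :=
  hK.isClosed_setOf_exists_eq (f := fun p : G × Z => p.1 • p.2) (g := fun p => q • p.2)
    (by fun_prop) (by fun_prop)

theorem exists_isOpen_forall_smul_ne {K : Set G} (hK : IsCompact K) {z : Z} {q : G}
    (hz : ∀ k ∈ K, k • z ≠ q • z) :
    ∃ O : Set Z, IsOpen O ∧ z ∈ O ∧ ∀ y ∈ O, ∀ y' ∈ O, ∀ k ∈ K, k • y' ≠ q • y := by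
  have hcl : IsClosed {t : Z × Z | ∃ k ∈ K, k • t.2 = q • t.1} :=
    hK.isClosed_setOf_exists_eq (f := fun p : G × Z × Z => p.1 • p.2.2)
      (g := fun p => q • p.2.1) (by fun_prop) (by fun_prop)
  obtain ⟨O₁, O₂, h₁, h₂, z₁, z₂, hO⟩ := isOpen_prod_iff.1 hcl.isOpen_compl z z
    (by rintro ⟨k, hk, e⟩; exact hz k hk e)
  exact ⟨O₁ ∩ O₂, h₁.inter h₂, ⟨z₁, z₂⟩, fun y hy y' hy' k hk e =>
    hO (show (y, y') ∈ O₁ ×ˢ O₂ from ⟨hy.1, hy'.2⟩) ⟨k, hk, e⟩⟩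

/-- On a small open set each of finitely many group elements either moves every point along `C`,
or never returns up to `C`. -/
theorem exists_isOpen_dichotomy {C : Set G} (hC : IsCompact C) (F : Finset G) {O : Set Z}
    (hO : IsOpen O) (hne : O.Nonempty) :
    ∃ O' ⊆ O, IsOpen O' ∧ O'.Nonempty ∧ ∀ q ∈ F, (∀ y ∈ O', ∃ c ∈ C, c • y = q • y) ∨
      ∀ y ∈ O', ∀ y' ∈ O', ∀ c ∈ C, c • y' ≠ q • y := by
  classical
  induction F using Finset.induction_on with
  | empty => exact ⟨O, Subset.rfl, hO, hne, by simp⟩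
  | insert p F _ ih =>
    obtain ⟨O', hO'O, hO', hne', h⟩ := ih
    by_cases hp : ∀ y ∈ O', ∃ c ∈ C, c • y = p • y
    · refine ⟨O', hO'O, hO', hne', fun q hq => ?_⟩
      rcases Finset.mem_insert.1 hq with rfl | hq
      exacts [.inl hp, h q hq]
    · push Not at hp
      obtain ⟨y, hy, hpy⟩ := hp
      obtain ⟨N, hN, hyN, hNp⟩ := exists_isOpen_forall_smul_ne hC hpy
      refine ⟨O' ∩ N, inter_subset_left.trans hO'O, hO'.inter hN, ⟨y, hy, hyN⟩, fun q hq => ?_⟩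
      rcases Finset.mem_insert.1 hq with rfl | hq
      · exact .inr fun a ha b hb => hNp a ha.2 b hb.2
      · exact (h q hq).imp (fun h a ha => h a ha.1) fun h a ha b hb => h a ha.1 b hb.1

end Returns

/-! ### Colouring a flow by finitely many open sets with small returns -/

section Colouring

open scoped Pointwise

variable {G : Type*} [Group G] [TopologicalSpace G] [IsTopologicalGroup G]

theorem exists_isCompact_nhds_one_inv_eq_mul_subset [LocallyCompactSpace G] {U : Set G}
    (hU : U ∈ 𝓝 1) : ∃ C ∈ 𝓝 (1 : G), IsCompact C ∧ C⁻¹ = C ∧ C * C ⊆ U := by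
  obtain ⟨K, hK, hKU, hKc⟩ := local_compact_nhds hU
  obtain ⟨C, hC, hcl, hinv, hmul⟩ := exists_closed_nhds_one_inv_eq_mul_subset hK
  refine ⟨C, hC, hKc.of_isClosed_subset hcl fun c hc => hmul ?_, hinv, hmul.trans hKU⟩
  exact ⟨c, hc, 1, mem_of_mem_nhds hC, mul_one c⟩

theorem IsCompact.exists_finset_mul_inv_mem {Q C : Set G} (hQ : IsCompact Q) (hC : C ∈ 𝓝 1) :
    ∃ t : Finset G, ∀ q ∈ Q, ∃ p ∈ t, q * p⁻¹ ∈ C := by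
  obtain ⟨t, -, ht⟩ := hQ.elim_nhds_subcover (fun p => (fun q => q * p⁻¹) ⁻¹' C) fun p _ => by
    refine (continuous_mul_const p⁻¹).continuousAt.preimage_mem_nhds ?_
    simpa using hC
  refine ⟨t, fun q hq => ?_⟩
  simpa using ht hq

variable {Z : Type*} [TopologicalSpace Z] [MulAction G Z] [ContinuousSMul G Z]

theorem exists_isOpen_returns_small [T2Space Z] [LocallyCompactSpace G] {Q U : Set G} (hQ : IsCompact Q)
    (hU : U ∈ 𝓝 1) {O : Set Z} (hO : IsOpen O) (hne : O.Nonempty) :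
    ∃ O' ⊆ O, IsOpen O' ∧ O'.Nonempty ∧
      ∀ y ∈ O', ∀ q ∈ Q, q • y ∈ O' → ∃ u ∈ U, u • y = q • y := by
  obtain ⟨C, hC, hCc, hinv, hmul⟩ := exists_isCompact_nhds_one_inv_eq_mul_subset hU
  obtain ⟨t, ht⟩ := hQ.exists_finset_mul_inv_mem hC
  obtain ⟨O', hO'O, hO', hne', h⟩ := exists_isOpen_dichotomy hCc t hO hne
  refine ⟨O', hO'O, hO', hne', fun y hy q hq hqy => ?_⟩
  obtain ⟨p, hp, hqp⟩ := ht q hq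
  -- Write `q = (q * p⁻¹) * p` with `q * p⁻¹ ∈ C`. If `p` moves `y` along `C`, then `q` moves it
  -- along `C * C ⊆ U`. Otherwise `q • y` cannot lie in `O'`, since `(q * p⁻¹)⁻¹ ∈ C` carries it to
  -- `p • y`.
  rcases h p hp with h | h
  · obtain ⟨c, hc, e⟩ := h y hy
    refine ⟨q * p⁻¹ * c, hmul ⟨_, hqp, c, hc, rfl⟩, ?_⟩
    rw [mul_smul, e, smul_smul, inv_mul_cancel_right]
  · refine absurd ?_ (h y hy _ hqy (q * p⁻¹)⁻¹ (by rw [← hinv]; simpa using hqp))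
    rw [smul_smul]
    simp

/-- Pigeonhole: `Q` is covered by finitely many translates `C * p`, and one translate cannot carry a
point into two colours that `U` does not connect, as `C * C ⊆ U`. With more colours than translates,
some colour is therefore out of reach. The number of colours depends on `Q` and `U` only, not on the
sets `T i`. -/
theorem exists_isOpen_forall_smul_notMem [LocallyCompactSpace G] {Q U : Set G} (hQ : IsCompact Q)
    (hU : U ∈ 𝓝 1) :
    ∃ n : ℕ, ∀ T : Fin n → Set Z, (∀ i, IsOpen (T i)) →
      (∀ i j, i ≠ j → ∀ y ∈ T i, ∀ u ∈ U, u • y ∉ T j) → ∀ O : Set Z, IsOpen O → O.Nonempty →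
      ∃ i, ∃ O' ⊆ O, IsOpen O' ∧ O'.Nonempty ∧ ∀ y ∈ O', ∀ q ∈ Q, q • y ∉ T i := by
  classical
  obtain ⟨C, hC, hCc, hinv, hmul⟩ := exists_isCompact_nhds_one_inv_eq_mul_subset hU
  obtain ⟨t, ht⟩ := hQ.exists_finset_mul_inv_mem hC
  refine ⟨t.card + 1, fun T hT hTU O hO hne => ?_⟩
  by_contra! hcon
  have key : ∀ s : Finset (Fin (t.card + 1)), ∃ O' ⊆ O, IsOpen O' ∧ O'.Nonempty ∧
      ∃ j : Fin (t.card + 1) → G, ∀ i ∈ s, j i ∈ t ∧ ∀ y ∈ O', ∃ c ∈ C, c • j i • y ∈ T i := by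
    intro s
    induction s using Finset.induction_on with
    | empty => exact ⟨O, Subset.rfl, hO, hne, fun _ => 1, by simp⟩
    | insert i s his ih =>
      obtain ⟨O', hO'O, hO', hne', j, hj⟩ := ih
      obtain ⟨y, hy, q, hq, hqy⟩ := hcon i O' hO'O hO' hne'
      obtain ⟨p, hp, hqp⟩ := ht q hq
      refine ⟨O' ∩ (fun y => (q * p⁻¹) • p • y) ⁻¹' T i, inter_subset_left.trans hO'O,
        hO'.inter ((hT i).preimage (by fun_prop)), ⟨y, hy, ?_⟩, Function.update j i p, ?_⟩
      · simpa [smul_smul] using hqy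
      · intro k hk
        by_cases hki : k = i
        · subst hki
          rw [Function.update_self]
          exact ⟨hp, fun y hy => ⟨_, hqp, hy.2⟩⟩
        · rw [Function.update_of_ne hki]
          have := hj k ((Finset.mem_insert.1 hk).resolve_left hki)
          exact ⟨this.1, fun y hy => this.2 y hy.1⟩
  obtain ⟨O', -, -, ⟨y, hy⟩, j, hj⟩ := key Finset.univ
  obtain ⟨i, -, i', -, hii, e⟩ := Finset.exists_ne_map_eq_of_card_lt_of_maps_to
    (s := Finset.univ) (t := t) (f := j) (by simp) fun i hi => (hj i hi).1
  obtain ⟨c, hc, h⟩ := (hj i (Finset.mem_univ i)).2 y hy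
  obtain ⟨c', hc', h'⟩ := (hj i' (Finset.mem_univ i')).2 y hy
  refine hTU i i' hii _ h (c' * c⁻¹) (hmul ⟨c', hc', c⁻¹, ?_, rfl⟩) ?_
  · rw [← hinv]; simpa using hc
  · rw [mul_smul, inv_smul_smul, e]
    exact h'

/-- Finitely many open sets whose returns under `Q` are all small, and whose `U`-translates
together are dense. -/
theorem exists_finite_family_returns_small [T2Space Z] [LocallyCompactSpace G] {Q U : Set G}
    (hQ : IsCompact Q) (hU : U ∈ 𝓝 1) (hUinv : ∀ u ∈ U, u⁻¹ ∈ U) :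
    ∃ (n : ℕ) (T : Fin n → Set Z), (∀ i, IsOpen (T i)) ∧
      (∀ i, ∀ y ∈ T i, ∀ q ∈ Q, q • y ∈ T i → ∃ u ∈ U, u • y = q • y) ∧
      Dense {z : Z | ∃ i, ∃ u ∈ U, u • z ∈ T i} := by
  -- Symmetrizing `Q` lets a set which `Q` cannot move into `T i` also be one which `T i` cannot be
  -- moved into.
  have hQ' : IsCompact (Q ∪ Q⁻¹) := hQ.union hQ.inv
  have hQinv : ∀ q ∈ Q ∪ Q⁻¹, q⁻¹ ∈ Q ∪ Q⁻¹ := fun q hq => by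
    rcases hq with hq | hq
    exacts [.inr (by simpa using hq), .inl hq]
  obtain ⟨n, hn⟩ := exists_isOpen_forall_smul_notMem (Z := Z) hQ' hU
  let P : Set (Fin n → Set Z) := {T | (∀ i, IsOpen (T i)) ∧
    (∀ i, ∀ y ∈ T i, ∀ q ∈ Q ∪ Q⁻¹, q • y ∈ T i → ∃ u ∈ U, u • y = q • y) ∧
    ∀ i j, i ≠ j → ∀ y ∈ T i, ∀ u ∈ U, u • y ∉ T j}
  -- The conditions involve at most two points at a time, so they survive unions of chains.
  obtain ⟨T, ⟨hTo, hTQ, hTU⟩, hTmax⟩ : ∃ T, Maximal (· ∈ P) T := by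
    refine zorn_le₀ P fun c hc hchain => ⟨fun i => ⋃ T ∈ c, T i, ⟨?_, ?_, ?_⟩, ?_⟩
    · exact fun i => isOpen_biUnion fun T hT => (hc hT).1 i
    · intro i y hy q hq hqy
      simp only [mem_iUnion] at hy hqy
      obtain ⟨T₁, h₁, hy⟩ := hy
      obtain ⟨T₂, h₂, hqy⟩ := hqy
      rcases hchain.total h₁ h₂ with h | h
      · exact (hc h₂).2.1 i y (h i hy) q hq hqy
      · exact (hc h₁).2.1 i y hy q hq (h i hqy)
    · intro i j hij y hy u hu huy
      simp only [mem_iUnion] at hy huy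
      obtain ⟨T₁, h₁, hy⟩ := hy
      obtain ⟨T₂, h₂, huy⟩ := huy
      rcases hchain.total h₁ h₂ with h | h
      · exact (hc h₂).2.2 i j hij y (h i hy) u hu huy
      · exact (hc h₁).2.2 i j hij y hy u hu (h j huy)
    · exact fun T hT i => subset_biUnion_of_mem (u := fun T : Fin n → Set Z => T i) hT
  refine ⟨n, T, hTo, fun i y hy q hq => hTQ i y hy q (.inl hq), ?_⟩
  rw [dense_iff_inter_open]
  intro O hO hne
  by_contra hemp
  have hOT : ∀ y ∈ O, ∀ i, ∀ u ∈ U, u • y ∉ T i := fun y hy i u hu h =>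
    hemp ⟨y, hy, i, u, hu, h⟩
  obtain ⟨O₁, hO₁O, hO₁, hne₁, hgood⟩ := exists_isOpen_returns_small hQ' hU hO hne
  obtain ⟨i, O', hO'O₁, hO', ⟨y₀, hy₀⟩, hi⟩ := hn T hTo hTU O₁ hO₁ hne₁
  -- If the translates miss `O`, some colour `i` is free on a smaller open set `O'`, and painting
  -- `O'` with it contradicts maximality.
  let T' : Fin n → Set Z := fun k => T k ∪ {z | k = i ∧ z ∈ O'}
  have hT' : T' ∈ P := by
    refine ⟨fun k => ?_, ?_, ?_⟩
    · refine (hTo k).union ?_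
      by_cases hk : k = i
      · simpa [hk] using hO'
      · simp [hk]
    · rintro k y (hy | ⟨hk, hy⟩) q hq (hqy | ⟨hk', hqy⟩)
      · exact hTQ k y hy q hq hqy
      · exact absurd (by simpa [hk'] using hy) (hi _ hqy q⁻¹ (hQinv q hq))
      · exact absurd (hk ▸ hqy) (hi y hy q hq)
      · exact hgood y (hO'O₁ hy) q hq (hO'O₁ hqy)
    · rintro k l hkl y (hy | ⟨hk, hy⟩) u hu (huy | ⟨hl, huy⟩)
      · exact hTU k l hkl y hy u hu huy
      · exact hOT _ (hO₁O (hO'O₁ huy)) k u⁻¹ (hUinv u hu) (by simpa using hy)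
      · exact hOT y (hO₁O (hO'O₁ hy)) l u hu huy
      · exact hkl (hk.trans hl.symm)
  have hy₀T : y₀ ∈ T i := hTmax hT' (fun k => subset_union_left) i (.inr ⟨rfl, hy₀⟩)
  exact hOT y₀ (hO₁O (hO'O₁ hy₀)) i 1 (mem_of_mem_nhds hU) (by simpa using hy₀T)

end Colouring

/-! ## Returns in irreducible extensions -/

/-- An open set that `K` moves off itself contains a whole fibre. If some `k ∈ K` fixes the base
point of that fibre, it maps the fibre to itself, which is absurd. -/
theorem IsIrreducibleExtension.isNowhereDense_returns {G : Type v} [Group G] [TopologicalSpace G]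
    {Z : Type w} {X : Type u} [TopologicalSpace Z] [T2Space Z] [MulAction G Z]
    [ContinuousSMul G Z] [TopologicalSpace X] [T2Space X] [MulAction G X] [ContinuousSMul G X]
    {π : Z → X} (hπ : IsIrreducibleExtension G π) {K : Set G} (hK : IsCompact K) :
    IsNowhereDense {z : Z | z ∉ (fun k : G => k • z) '' K ∧
      π z ∈ (fun k : G => k • π z) '' K} := by
  have hcl : IsClosed {z : Z | π z ∈ (fun k : G => k • π z) '' K} := by
    have := (isClosed_setOf_exists_smul_eq (Z := X) hK 1).preimage hπ.continuous
    simpa [preimage, mem_image] using this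
  rw [IsNowhereDense, eq_empty_iff_forall_notMem]
  intro a ha
  obtain ⟨z, hzI, hz, -⟩ := mem_closure_iff.1 (interior_subset ha) _ isOpen_interior ha
  obtain ⟨O, hO, hzO, hOK⟩ := exists_isOpen_forall_smul_ne hK (z := z) (q := 1)
    fun k hk e => hz ⟨k, hk, by simpa using e⟩
  obtain ⟨x, hx⟩ := hπ.irreducible _ (hO.inter isOpen_interior) ⟨z, hzO, hzI⟩
  obtain ⟨y, rfl⟩ := hπ.surjective x
  have hy := hx (show y ∈ π ⁻¹' {π y} from rfl)
  -- The fibre found lies only in the closure of the set in question, but the condition on `π` is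
  -- closed and so persists there.
  obtain ⟨k, hk, e⟩ := closure_minimal (fun _ h => h.2) hcl (interior_subset hy.2)
  have hky := hx (show k • y ∈ π ⁻¹' {π y} from (hπ.map_smul k y).trans e)
  exact hOK (k • y) hky.1 y hy.1 k hk (one_smul G _).symm

theorem IsIrreducibleExtension.frequently_genericFilter {G : Type v} {Z : Type w} {X : Type u}
    [TopologicalSpace Z] [CompactSpace Z] [TopologicalSpace X] [T2Space X] [SMul G Z] [SMul G X]
    {π : Z → X} (hπ : IsIrreducibleExtension G π) {X' : Set X} (hX' : Dense X') (z : Z) :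
    ∃ᶠ y in 𝓝 z ⊓ genericFilter Z, π y ∈ X' := by
  rw [Filter.frequently_iff]
  intro s hs
  obtain ⟨O, hO, hne, hOs⟩ := exists_isOpen_subset_of_mem_nhds_inf_genericFilter hs
  obtain ⟨x, hxO, hx⟩ := hX'.inter_open_nonempty _
    (IrreducibleExtension.isOpen_fiberImage hπ.continuous hO) (hπ.irreducible O hO hne)
  obtain ⟨y, rfl⟩ := hπ.surjective x
  exact ⟨y, hOs (hxO rfl), hx⟩

/-! ## Adjoining an equicontinuous function to a flow -/

section OrbitGraph

open Filter

variable {G : Type*} [Group G] {Z : Type*} [TopologicalSpace Z] [MulAction G Z]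

theorem preimage_smul_mem_genericFilter [ContinuousConstSMul G Z] (k : G) {D : Set Z}
    (hD : D ∈ genericFilter Z) : (fun z => k • z) ⁻¹' D ∈ genericFilter Z := by
  rw [mem_genericFilter] at hD ⊢
  have h := (Homeomorph.smul (α := Z) k).preimage_interior D
  have h' : Dense (Homeomorph.smul (α := Z) k ⁻¹' interior D) :=
    hD.preimage (Homeomorph.smul k).isOpenMap
  rw [h] at h'
  exact h'

/-- On the part of `O` where `f` exceeds `sSup (f '' O) - ε`, open by semicontinuity, all values lie
within `ε` of each other. -/
theorem LowerSemicontinuous.dist_lt_mem_genericFilter {f : Z → ℝ} (hf : LowerSemicontinuous f)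
    (hb : BddAbove (range f)) {ε : ℝ} (hε : 0 < ε) :
    {z | ∀ᶠ y in 𝓝 z, dist (f y) (f z) < ε} ∈ genericFilter Z := by
  rw [mem_genericFilter, dense_iff_inter_open]
  intro O hO hne
  obtain ⟨_, ⟨y, hy, rfl⟩, hyε⟩ := exists_lt_of_lt_csSup (hne.image f) (sub_lt_self _ hε)
  have hO' : IsOpen (O ∩ f ⁻¹' Ioi (sSup (f '' O) - ε)) :=
    hO.inter (hf.isOpen_preimage _)
  refine ⟨y, hy, mem_interior.2 ⟨_, fun z hz => ?_, hO', hy, hyε⟩⟩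
  filter_upwards [hO'.mem_nhds hz] with x hx
  have hle : ∀ t ∈ O, f t ≤ sSup (f '' O) := fun t ht =>
    le_csSup (hb.mono (image_subset_range f O)) ⟨t, ht, rfl⟩
  have h1 := hle x hx.1
  have h2 := hle z hz.1
  have h3 : sSup (f '' O) - ε < f x := hx.2
  have h4 : sSup (f '' O) - ε < f z := hz.2
  rw [Real.dist_eq, abs_lt]
  constructor <;> linarith

/-- A point of `Z` together with the values of `f` along its orbit. -/
def orbitGraph (G : Type*) [SMul G Z] (f : Z → ℝ) (z : Z) : Z × (G → ℝ) := (z, fun g => f (g • z))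

/-- The limits of the graph of `orbitGraph G f` along all generic sets. -/
def genericClosure (G : Type*) [SMul G Z] (f : Z → ℝ) : Set (Z × (G → ℝ)) :=
  {p | ∀ D ∈ genericFilter Z, p ∈ closure (orbitGraph G f '' D)}

variable {f : Z → ℝ}

theorem isClosed_genericClosure : IsClosed (genericClosure G f) := by
  simp only [genericClosure, ofPred_forall]
  exact isClosed_biInter fun _ _ => isClosed_closure

theorem genericClosure_subset {C : Set (Z × (G → ℝ))} (hC : IsClosed C)
    (h : ∀ z, orbitGraph G f z ∈ C) : genericClosure G f ⊆ C := fun p hp =>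
  closure_minimal (by rintro _ ⟨z, -, rfl⟩; exact h z) hC (hp univ univ_mem)

theorem isCompact_genericClosure [CompactSpace Z] (hf : ∀ z, f z ∈ Icc 0 1) :
    IsCompact (genericClosure G f) := by
  have hK : IsCompact ((univ : Set Z) ×ˢ (univ.pi fun _ : G => Icc (0 : ℝ) 1)) :=
    isCompact_univ.prod (isCompact_univ_pi fun _ => isCompact_Icc)
  refine hK.of_isClosed_subset isClosed_genericClosure (genericClosure_subset ?_ fun z => ?_)
  · exact isClosed_univ.prod (isClosed_set_pi fun _ _ => isClosed_Icc)
  · exact ⟨trivial, fun g _ => hf _⟩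

theorem smul_mem_genericClosure [ContinuousConstSMul G Z] (k : G) {p : Z × (G → ℝ)}
    (hp : p ∈ genericClosure G f) : (k • p.1, fun g => p.2 (g * k)) ∈ genericClosure G f := by
  intro D hD
  have hc : Continuous fun p : Z × (G → ℝ) => ((k • p.1, fun g => p.2 (g * k)) : Z × (G → ℝ)) := by
    fun_prop
  refine map_mem_closure (f := fun p : Z × (G → ℝ) => (k • p.1, fun g => p.2 (g * k))) hc
    (hp _ (preimage_smul_mem_genericFilter k hD)) ?_
  rintro _ ⟨z, hz, rfl⟩
  exact ⟨k • z, hz, by simp [orbitGraph, mul_smul]⟩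

theorem exists_mem_genericClosure [T2Space Z] [CompactSpace Z] (hf : ∀ z, f z ∈ Icc 0 1) (z : Z) :
    ∃ p ∈ genericClosure G f, p.1 = z := by
  have hK : IsCompact ((univ : Set Z) ×ˢ (univ.pi fun _ : G => Icc (0 : ℝ) 1)) :=
    isCompact_univ.prod (isCompact_univ_pi fun _ => isCompact_Icc)
  let 𝒲 := Ultrafilter.of (𝓝 z ⊓ genericFilter Z)
  have h𝒲 : (𝒲 : Filter Z) ≤ 𝓝 z ⊓ genericFilter Z := Ultrafilter.of_le _
  obtain ⟨p, -, hp⟩ := hK.ultrafilter_le_nhds (𝒲.map (orbitGraph G f))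
    (le_principal_iff.2 (mem_map.2 (univ_mem' fun y => ⟨trivial, fun g _ => hf _⟩)))
  have hp' : Tendsto (orbitGraph G f) 𝒲 (𝓝 p) := hp
  refine ⟨p, fun D hD => ?_, ?_⟩
  · exact mem_closure_of_tendsto hp' (mem_of_superset (h𝒲 (mem_inf_of_right hD))
      fun y hy => ⟨y, hy, rfl⟩)
  · exact tendsto_nhds_unique ((continuous_fst.tendsto p).comp hp') (h𝒲.trans inf_le_left)

theorem exists_dist_lt_of_mem_genericClosure {p : Z × (G → ℝ)} (hp : p ∈ genericClosure G f)
    {N : Set Z} (hN : N ∈ 𝓝 p.1) {D : Set Z} (hD : D ∈ genericFilter Z) (S : Finset G)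
    {ε : G → ℝ} (hε : ∀ s ∈ S, 0 < ε s) :
    ∃ z ∈ N, z ∈ D ∧ ∀ s ∈ S, dist (f (s • z)) (p.2 s) < ε s := by
  have hM : {q : Z × (G → ℝ) | q.1 ∈ N ∧ ∀ s ∈ S, dist (q.2 s) (p.2 s) < ε s} ∈ 𝓝 p := by
    refine inter_mem (continuous_fst.continuousAt.preimage_mem_nhds hN) ?_
    refine (eventually_all_finset S).2 fun s hs => ?_
    have hc : Continuous fun q : Z × (G → ℝ) => dist (q.2 s) (p.2 s) := by fun_prop
    exact hc.continuousAt.eventually_lt continuousAt_const (by simpa using hε s hs)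
  obtain ⟨_, h, z, hz, rfl⟩ := mem_closure_iff_nhds.1 (hp D hD) _ hM
  exact ⟨z, h.1, hz, h.2⟩

/-- A basic open set tests finitely many orbit values up to finitely many errors. At a generic `z`
each of these values oscillates little, so all limit values over `z` nearly agree and the whole
fibre over `z` stays in the open set. Only finite intersections of generic sets occur, so no Baire
argument is needed. -/
theorem isIrreducibleMap_genericClosure [T2Space Z] [CompactSpace Z] [ContinuousConstSMul G Z]
    (hosc : ∀ ε > 0, {z | ∀ᶠ y in 𝓝 z, dist (f y) (f z) < ε} ∈ genericFilter Z) :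
    IsIrreducibleMap fun p : genericClosure G f => p.1.1 := by
  rintro _ hV ⟨p, hp⟩
  obtain ⟨U, hU, rfl⟩ := isOpen_induced_iff.1 hV
  obtain ⟨N, M, hN, hM, hpN, hpM, hNM⟩ := isOpen_prod_iff.1 hU p.1.1 p.1.2 hp
  obtain ⟨S, u, hu, hSu⟩ := isOpen_pi_iff.1 hM _ hpM
  choose! ε hε hεu using fun s hs => Metric.isOpen_iff.1 (hu s hs).1 _ (hu s hs).2
  have hε3 : ∀ s ∈ S, 0 < ε s / 3 := fun s hs => div_pos (hε s hs) three_pos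
  let D : Set Z := {z | ∀ s ∈ S, ∀ᶠ y in 𝓝 z, dist (f (s • y)) (f (s • z)) < ε s / 3}
  have hD : D ∈ genericFilter Z := by
    refine (eventually_all_finset S).2 fun s hs => ?_
    filter_upwards [preimage_smul_mem_genericFilter s (hosc _ (hε3 s hs))] with z hz
    exact (continuous_const_smul s).continuousAt.eventually hz
  obtain ⟨z, hzN, hzD, hz⟩ := exists_dist_lt_of_mem_genericClosure p.2 (hN.mem_nhds hpN) hD S hε3
  refine ⟨z, fun q hq => hNM ⟨?_, hSu fun s hs => hεu s hs ?_⟩⟩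
  · rw [show q.1.1 = z from hq]
    exact hzN
  · have hev : ∀ᶠ y in 𝓝 q.1.1, ∀ s ∈ S, dist (f (s • y)) (f (s • z)) < ε s / 3 := by
      rw [show q.1.1 = z from hq]
      exact (eventually_all_finset S).2 hzD
    obtain ⟨y, hy, -, hyq⟩ := exists_dist_lt_of_mem_genericClosure q.2 hev univ_mem S hε3
    have h1 := hyq s hs
    have h2 := hy s hs
    have h3 := hz s hs
    rw [dist_comm] at h1
    rw [Metric.mem_ball]
    linarith [dist_triangle4 (q.1.2 s) (f (s • y)) (f (s • z)) (p.1.2 s)]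

/-- `G` acts on the second coordinate by translating the argument on the right. The product topology
on `G → ℝ` ignores the topology of `G`, so joint continuity of the action has to come from `hequi`,
which passes to limits uniformly. -/
theorem exists_isIrreducibleExtension_genericClosure [TopologicalSpace G] [IsTopologicalGroup G]
    [T2Space Z] [CompactSpace Z] [ContinuousSMul G Z] (hf : ∀ z, f z ∈ Icc 0 1)
    (hosc : ∀ ε > 0, {z | ∀ᶠ y in 𝓝 z, dist (f y) (f z) < ε} ∈ genericFilter Z)
    (hequi : ∀ ε > 0, ∀ᶠ g in 𝓝 (1 : G), ∀ z, dist (f (g • z)) (f z) ≤ ε) :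
    ∃ (_ : MulAction G (genericClosure G f)) (_ : ContinuousSMul G (genericClosure G f)),
      IsIrreducibleExtension G fun p : genericClosure G f => p.1.1 := by
  let α : MulAction G (genericClosure G f) :=
    { smul := fun k p => ⟨(k • p.1.1, fun g => p.1.2 (g * k)), smul_mem_genericClosure k p.2⟩
      one_smul := fun p => Subtype.ext (Prod.ext (one_smul G p.1.1)
        (funext fun g => congrArg p.1.2 (mul_one g)))
      mul_smul := fun k l p => Subtype.ext (Prod.ext (mul_smul k l p.1.1)
        (funext fun g => congrArg p.1.2 (mul_assoc g k l).symm)) }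
  have hequi' : ∀ ε > 0, ∀ᶠ g in 𝓝 (1 : G), ∀ p : genericClosure G f, ∀ h,
      dist (p.1.2 (g * h)) (p.1.2 h) ≤ ε := by
    intro ε hε
    filter_upwards [hequi ε hε] with g hg p h
    refine genericClosure_subset (C := {p | dist (p.2 (g * h)) (p.2 h) ≤ ε})
      (isClosed_le (by fun_prop) continuous_const) (fun z => ?_) p.2
    simpa [orbitGraph, mul_smul] using hg (h • z)
  refine ⟨α, ⟨Continuous.subtype_mk (.prodMk ?_ (continuous_pi fun g => ?_)) _⟩,
    ⟨⟨by fun_prop, fun k p => rfl⟩, fun z => ?_, isIrreducibleMap_genericClosure hosc⟩⟩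
  · fun_prop
  · refine continuous_iff_continuousAt.2 fun ⟨k, p⟩ => Metric.tendsto_nhds.2 fun ε hε => ?_
    -- Since `g * q.1 = (g * q.1 * (g * k)⁻¹) * (g * k)` and the bracket tends to `1`,
    -- equicontinuity compares the coordinates at `g * q.1` and `g * k`.
    have h1 : ∀ᶠ q : G × genericClosure G f in 𝓝 (k, p), ∀ p' : genericClosure G f, ∀ h,
        dist (p'.1.2 (g * q.1 * (g * k)⁻¹ * h)) (p'.1.2 h) ≤ ε / 2 := by
      have hc : Continuous fun q : G × genericClosure G f => g * q.1 * (g * k)⁻¹ := by fun_prop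
      refine (hc.tendsto (k, p)).eventually (p := fun a => ∀ p' : genericClosure G f, ∀ h,
        dist (p'.1.2 (a * h)) (p'.1.2 h) ≤ ε / 2) ?_
      simpa using hequi' (ε / 2) (half_pos hε)
    have h2 : ∀ᶠ q : G × genericClosure G f in 𝓝 (k, p),
        dist (q.2.1.2 (g * k)) (p.1.2 (g * k)) < ε / 2 := by
      have hc : Continuous fun q : G × genericClosure G f =>
        dist (q.2.1.2 (g * k)) (p.1.2 (g * k)) := by fun_prop
      exact hc.continuousAt.eventually_lt continuousAt_const (by simpa using half_pos hε)
    filter_upwards [h1, h2] with q hq1 hq2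
    have := hq1 q.2 (g * k)
    rw [inv_mul_cancel_right] at this
    linarith [dist_triangle (q.2.1.2 (g * q.1)) (q.2.1.2 (g * k)) (p.1.2 (g * k))]
  · obtain ⟨p, hp, rfl⟩ := exists_mem_genericClosure (G := G) hf z
    exact ⟨⟨p, hp⟩, rfl⟩

end OrbitGraph

/-! ### Splitting over the universal extension and continuous modifications -/

theorem IsIrreducibleExtension.comp {G : Type*} {Y Z X : Type*} [TopologicalSpace Y]
    [CompactSpace Y] [TopologicalSpace Z] [T2Space Z] [TopologicalSpace X] [SMul G Y] [SMul G Z]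
    [SMul G X] {π : Z → X} {ρ : Y → Z} (hπ : IsIrreducibleExtension G π)
    (hρ : IsIrreducibleExtension G ρ) : IsIrreducibleExtension G (π ∘ ρ) := by
  refine ⟨⟨hπ.continuous.comp hρ.continuous, fun g y => ?_⟩, hπ.surjective.comp hρ.surjective,
    fun U hU hne => ?_⟩
  · simp only [Function.comp_apply, hρ.map_smul, hπ.map_smul]
  · obtain ⟨x, hx⟩ := hπ.irreducible _
      (IrreducibleExtension.isOpen_fiberImage hρ.continuous hU) (hρ.irreducible U hU hne)
    exact ⟨x, fun y hy => hx (show ρ y ∈ π ⁻¹' {x} from hy) rfl⟩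

/-- A universal irreducible extension splits every irreducible extension of itself. -/
theorem IsUniversalIrreducibleExtension.exists_section {G : Type v} [Group G]
    [TopologicalSpace G] {Z X : Type u} [TopologicalSpace Z] [CompactSpace Z] [T2Space Z]
    [TopologicalSpace X] [MulAction G Z] [MulAction G X] {π : Z → X}
    (hπ : IsUniversalIrreducibleExtension G π) {Y : Type w} [TopologicalSpace Y] [CompactSpace Y]
    [T2Space Y] [MulAction G Y] [ContinuousSMul G Y] {ρ : Y → Z}
    (hρ : IsIrreducibleExtension G ρ) : ∃ s : Z → Y, Continuous s ∧ ∀ z, ρ (s z) = z := by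
  obtain ⟨s, hs, h⟩ := hπ.exists_factorization Y (π ∘ ρ) (hπ.toIsIrreducibleExtension.comp hρ)
  -- Universality over `X` only gives `π ∘ ρ ∘ s = π`. Rigidity of irreducible extensions upgrades
  -- this to `ρ ∘ s = id`.
  refine ⟨s, hs.continuous, congrFun (IrreducibleExtension.map_unique (f := ρ ∘ s) (g := id)
    (σ := id) hπ.surjective hπ.irreducible hπ.irreducible Function.bijective_id
    (hρ.continuous.comp hs.continuous) continuous_id (congrFun h) fun _ => rfl)⟩

/-- On a universal irreducible extension, a generically almost continuous function which is
uniformly equicontinuous along orbits has a continuous modification. -/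
theorem IsUniversalIrreducibleExtension.exists_continuous_modification {G : Type v} [Group G]
    [TopologicalSpace G] [IsTopologicalGroup G] {Z X : Type u} [TopologicalSpace Z]
    [CompactSpace Z] [T2Space Z] [TopologicalSpace X] [MulAction G Z] [ContinuousSMul G Z]
    [MulAction G X] {π : Z → X} (hπ : IsUniversalIrreducibleExtension G π) {f : Z → ℝ}
    (hf : ∀ z, f z ∈ Icc 0 1)
    (hosc : ∀ ε > 0, {z | ∀ᶠ y in 𝓝 z, dist (f y) (f z) < ε} ∈ genericFilter Z)
    (hequi : ∀ ε > 0, ∀ᶠ g in 𝓝 (1 : G), ∀ z, dist (f (g • z)) (f z) ≤ ε) :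
    ∃ f' : Z → ℝ, Continuous f' ∧
      ∀ (A : Set Z) (c : ℝ), IsOpen A → (∀ z ∈ A, f z = c) → ∀ z ∈ A, f' z = c := by
  obtain ⟨_, _, hρ⟩ := exists_isIrreducibleExtension_genericClosure hf hosc hequi
  have : CompactSpace (genericClosure G f) :=
    isCompact_iff_compactSpace.1 (isCompact_genericClosure hf)
  obtain ⟨s, hs, h⟩ := hπ.exists_section hρ
  -- The coordinate at `1` records limits of `f` itself. Over an open set where `f` is constant, the
  -- only limit value is that constant.
  refine ⟨fun z => (s z).1.2 1, by fun_prop, fun A c hA hfA z hz => ?_⟩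
  refine (eq_of_forall_dist_le fun ε hε => ?_).symm
  obtain ⟨y, hy, -, hyε⟩ := exists_dist_lt_of_mem_genericClosure (s z).2
    (hA.mem_nhds (show (s z).1.1 ∈ A from (h z).symm ▸ hz)) Filter.univ_mem {1} (ε := fun _ => ε)
    (fun _ _ => hε)
  have := hyε 1 (Finset.mem_singleton_self 1)
  rw [one_smul, hfA y hy] at this
  exact this.le

/-! ## Separation of open sets -/

section Separation

open Filter

/-- A compactly supported Urysohn function is uniformly continuous. The left uniformity is used
because replacing `z` by `g • z` in `orbitSup` translates the argument of `φ` on the right. -/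
theorem exists_bump_one {G : Type*} [Group G] [TopologicalSpace G] [IsTopologicalGroup G]
    [LocallyCompactSpace G] {W : Set G} (hW : W ∈ 𝓝 1) :
    ∃ φ : G → ℝ, (∀ h, φ h ∈ Icc 0 1) ∧ φ 1 = 1 ∧ (∀ h ∉ W, φ h = 0) ∧
      ∀ ε > 0, ∀ᶠ g in 𝓝 (1 : G), ∀ h, dist (φ h) (φ (h * g)) < ε := by
  obtain ⟨φ, h1, h0, hc, hI⟩ := exists_continuous_one_zero_of_isCompact (s := {(1 : G)})
    (t := (interior W)ᶜ) isCompact_singleton isOpen_interior.isClosed_compl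
    (disjoint_singleton_left.2 fun h => h (mem_interior_iff_mem_nhds.2 hW))
  refine ⟨φ, hI, h1 rfl, fun h hh => h0 fun hi => hh (interior_subset hi), fun ε hε => ?_⟩
  let _ : UniformSpace G := IsTopologicalGroup.leftUniformSpace G
  have hu : UniformContinuous φ := hc.uniformContinuous_of_continuous φ.continuous
  obtain ⟨V, hV, hVs⟩ := mem_comap.1 (hu (Metric.dist_mem_uniformity hε))
  filter_upwards [hV] with g hg h
  exact hVs (show (h, h * g).1⁻¹ * (h, h * g).2 ∈ V by simpa using hg)

/-- The function `z ↦ sup {φ h | h • z ∈ A}`. -/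
noncomputable def orbitSup {G Z : Type*} [SMul G Z] (φ : G → ℝ) (A : Set Z) (z : Z) : ℝ :=
  ⨆ h : G, A.indicator (fun _ => φ h) (h • z)

variable {G Z : Type*} [Group G] [MulAction G Z] {φ : G → ℝ}

theorem bddAbove_range_indicator (hφ : ∀ h, φ h ∈ Icc 0 1) (A : Set Z) (z : Z) :
    BddAbove (range fun h : G => A.indicator (fun _ => φ h) (h • z)) := by
  refine ⟨1, ?_⟩
  rintro _ ⟨h, rfl⟩
  exact indicator_apply_le' (fun _ => (hφ h).2) fun _ => zero_le_one

theorem le_orbitSup (hφ : ∀ h, φ h ∈ Icc 0 1) {A : Set Z} {z : Z} {h : G} (hz : h • z ∈ A) :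
    φ h ≤ orbitSup φ A z := by
  have := le_ciSup (bddAbove_range_indicator hφ A z) h
  rwa [indicator_of_mem hz] at this

theorem orbitSup_le {A : Set Z} {z : Z} {c : ℝ} (hc : 0 ≤ c) (h : ∀ h : G, h • z ∈ A → φ h ≤ c) :
    orbitSup φ A z ≤ c :=
  ciSup_le fun k => indicator_apply_le' (h k) fun _ => hc

theorem orbitSup_mem_Icc (hφ : ∀ h, φ h ∈ Icc 0 1) (A : Set Z) (z : Z) :
    orbitSup φ A z ∈ Icc 0 1 :=
  ⟨Real.iSup_nonneg fun h => indicator_nonneg (fun _ _ => (hφ h).1) _,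
    orbitSup_le zero_le_one fun h _ => (hφ h).2⟩

theorem lowerSemicontinuous_orbitSup [TopologicalSpace Z] [ContinuousConstSMul G Z]
    (hφ : ∀ h, φ h ∈ Icc 0 1) {A : Set Z} (hA : IsOpen A) :
    LowerSemicontinuous (orbitSup φ A) :=
  lowerSemicontinuous_ciSup (bddAbove_range_indicator hφ A) fun h =>
    (hA.preimage (continuous_const_smul h)).lowerSemicontinuous_indicator (hφ h).1

theorem orbitSup_smul_le (hφ : ∀ h, φ h ∈ Icc 0 1) {A : Set Z} {g : G} {ε : ℝ} (hε : 0 ≤ ε)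
    (h : ∀ h, φ h ≤ φ (h * g) + ε) (z : Z) : orbitSup φ A (g • z) ≤ orbitSup φ A z + ε := by
  refine orbitSup_le (add_nonneg (orbitSup_mem_Icc hφ A z).1 hε) fun k hk => (h k).trans ?_
  gcongr
  exact le_orbitSup hφ (by rwa [mul_smul])

theorem dist_orbitSup_smul_le (hφ : ∀ h, φ h ∈ Icc 0 1) {A : Set Z} {g : G} {ε : ℝ} (hε : 0 ≤ ε)
    (h : ∀ h, dist (φ h) (φ (h * g)) < ε) (z : Z) :
    dist (orbitSup φ A (g • z)) (orbitSup φ A z) ≤ ε := by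
  have h1 := orbitSup_smul_le (A := A) (g := g) hφ hε (fun k => by
    have := abs_lt.1 (h k); linarith) z
  have h2 := orbitSup_smul_le (A := A) (g := g⁻¹) hφ hε (fun k => by
    have := abs_lt.1 (h (k * g⁻¹))
    rw [inv_mul_cancel_right] at this
    linarith) (g • z)
  rw [inv_smul_smul] at h2
  rw [Real.dist_eq, abs_le]
  constructor <;> linarith

end Separation

/-- `orbitSup φ A` is `1` on `A` and, as `φ` vanishes off `W`, `0` on `B`. Its continuous
modification keeps both values, hence takes them on the closures. For discrete `G` one may take `W =
{1}`, and `Z` is then extremally disconnected. -/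
theorem IsUniversalIrreducibleExtension.disjoint_closure {G : Type v} [Group G]
    [TopologicalSpace G] [IsTopologicalGroup G] [LocallyCompactSpace G] {Z X : Type u}
    [TopologicalSpace Z] [CompactSpace Z] [T2Space Z] [TopologicalSpace X] [MulAction G Z]
    [ContinuousSMul G Z] [MulAction G X] {π : Z → X} (hπ : IsUniversalIrreducibleExtension G π)
    {A B : Set Z} (hA : IsOpen A) (hB : IsOpen B) {W : Set G} (hW : W ∈ 𝓝 1)
    (hWB : ∀ w ∈ W, ∀ z ∈ B, w • z ∉ A) : Disjoint (closure A) (closure B) := by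
  obtain ⟨φ, hφ, hφ1, hφW, hφu⟩ := exists_bump_one hW
  obtain ⟨f, hf, hfc⟩ := hπ.exists_continuous_modification (orbitSup_mem_Icc hφ A)
    (fun ε hε => (lowerSemicontinuous_orbitSup hφ hA).dist_lt_mem_genericFilter
      ⟨1, by rintro _ ⟨z, rfl⟩; exact (orbitSup_mem_Icc hφ A z).2⟩ hε)
    (fun ε hε => by
      filter_upwards [hφu ε hε] with g hg z
      exact dist_orbitSup_smul_le hφ (le_of_lt hε) hg z)
  have h1 : closure A ⊆ f ⁻¹' {1} := by
    refine closure_minimal (hfc A 1 hA fun z hz => ?_) (isClosed_singleton.preimage hf)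
    refine le_antisymm (orbitSup_mem_Icc hφ A z).2 (hφ1.symm.le.trans (le_orbitSup hφ ?_))
    rwa [one_smul]
  have h0 : closure B ⊆ f ⁻¹' {0} := by
    refine closure_minimal (hfc B 0 hB fun z hz => ?_) (isClosed_singleton.preimage hf)
    refine le_antisymm (orbitSup_le le_rfl fun h hh => ?_) (orbitSup_mem_Icc hφ A z).1
    exact (hφW h fun hw => hWB h hw z hz hh).le
  exact disjoint_left.2 fun z hzA hzB => by
    have := (h1 hzA).symm.trans (h0 hzB)
    norm_num at this

/-! ## Continuity of the stabilizer map of the universal irreducible extension -/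

section FixedPoints

open Filter
open scoped Pointwise

/-- Otherwise `z` is a limit of points that no element near `g` fixes. The colouring places `z` in
the closure of one colour class of such points, which `g` moves uniformly off itself. By
`disjoint_closure` the point `z` cannot then be fixed by `g`. -/
theorem IsUniversalIrreducibleExtension.eventually_exists_mul_smul_eq {G : Type v} [Group G]
    [TopologicalSpace G] [IsTopologicalGroup G] [LocallyCompactSpace G] {Z X : Type u}
    [TopologicalSpace Z] [CompactSpace Z] [T2Space Z] [TopologicalSpace X] [MulAction G Z]
    [ContinuousSMul G Z] [MulAction G X] {π : Z → X} (hπ : IsUniversalIrreducibleExtension G π)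
    {z : Z} {g : G} (hg : g • z = z) {V : Set G} (hV : V ∈ 𝓝 1) :
    ∀ᶠ y in 𝓝 z, ∃ v ∈ V, (v * g) • y = y := by
  obtain ⟨C, hC, hCc, -, hCV⟩ := exists_isCompact_nhds_one_inv_eq_mul_subset hV
  obtain ⟨U, hU, hUc, hUinv, hUC⟩ := exists_isCompact_nhds_one_inv_eq_mul_subset hC
  have hUinv' : ∀ u ∈ U, u⁻¹ ∈ U := fun u hu => by rw [← hUinv]; simpa using hu
  -- `C * C` replaces `V` because its compactness makes `A` open.
  let A : Set Z := {y | ∃ v ∈ C * C, (v * g) • y = y}ᶜ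
  have hA : IsOpen A := ((hCc.mul hCc).isClosed_setOf_exists_eq
    (f := fun p : G × Z => (p.1 * g) • p.2) (g := fun p => p.2) (by fun_prop)
    (by fun_prop)).isOpen_compl
  by_contra hcon
  have hzA : z ∈ closure A := by
    rw [mem_closure_iff_frequently]
    refine (not_eventually.1 hcon).mono fun y hy ⟨v, hv, e⟩ => hy ⟨v, hCV hv, e⟩
  -- The compact set `U * U * {g} * U` contains the elements `u₂ * w * g * u₁⁻¹` that arise when a
  -- point of `g • B i` is moved by `w ∈ U` into `B i`.
  obtain ⟨n, T, hT, hTQ, hTd⟩ := exists_finite_family_returns_small (Z := Z)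
    (((hUc.mul hUc).mul (isCompact_singleton (x := g))).mul hUc) hU hUinv'
  let B : Fin n → Set Z := fun i => A ∩ {y | ∃ u ∈ U, u • y ∈ T i}
  have hB : ∀ i, IsOpen (B i) := fun i => by
    refine hA.inter ?_
    have : {y | ∃ u ∈ U, u • y ∈ T i} = ⋃ u ∈ U, (fun y => u • y) ⁻¹' T i := by
      ext; simp
    rw [this]
    exact isOpen_biUnion fun u _ => (hT i).preimage (continuous_const_smul u)
  obtain ⟨i, hi⟩ : ∃ i, z ∈ closure (B i) := by
    -- Finiteness of the colouring is essential here: `z` lies in the closure of a single class.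
    rw [← mem_iUnion, ← closure_iUnion_of_finite]
    refine closure_minimal ((hTd.open_subset_closure_inter hA).trans (closure_mono ?_))
      isClosed_closure hzA
    rintro y ⟨hy, i, h⟩
    exact mem_iUnion.2 ⟨i, hy, h⟩
  have hdisj := hπ.disjoint_closure (hB i) ((hB i).preimage (continuous_const_smul g⁻¹)) hU
    fun w hw y hy hwy => ?_
  · refine disjoint_left.1 hdisj hi (hg ▸ map_mem_closure (continuous_const_smul g) hi ?_)
    intro y hy
    simpa using hy
  · obtain ⟨x, rfl⟩ : ∃ x, y = g • x := ⟨g⁻¹ • y, (smul_inv_smul g y).symm⟩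
    simp only [mem_preimage, inv_smul_smul] at hy
    obtain ⟨hxA, u₁, hu₁, h₁⟩ := hy
    obtain ⟨-, u₂, hu₂, h₂⟩ := hwy
    obtain ⟨u₃, hu₃, e⟩ := hTQ i _ h₁ (u₂ * w * g * u₁⁻¹)
      (mul_mem_mul (mul_mem_mul (mul_mem_mul hu₂ hw) rfl) (hUinv' _ hu₁))
      (by simpa [mul_smul] using h₂)
    -- The small return `u₃` gives `(u₂ * w * g) • x = u₃ • u₁ • x`, so `u₁⁻¹ * u₃⁻¹ * (u₂ * w) * g`
    -- fixes `x`. Its first four factors pair off into `C * C`, against `x ∈ A`.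
    refine hxA ⟨u₁⁻¹ * u₃⁻¹ * (u₂ * w), mul_mem_mul
      (hUC (mul_mem_mul (hUinv' _ hu₁) (hUinv' _ hu₃))) (hUC (mul_mem_mul hu₂ hw)), ?_⟩
    have e' : (u₂ * w * g) • x = u₃ • u₁ • x := by simpa [mul_smul] using e.symm
    rw [mul_assoc, mul_smul, e', mul_smul, inv_smul_smul, inv_smul_smul]

end FixedPoints

/-! ### The Chabauty topology on closed subgroups -/

section Chabauty

open Filter

variable {G : Type v} [Group G] [TopologicalSpace G]

theorem ClosedSubgroup.tendsto_nhds {ι : Type*} {l : Filter ι} {F : ι → ClosedSubgroup G}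
    {H : ClosedSubgroup G}
    (hK : ∀ K : Set G, IsCompact K → (∀ g ∈ K, g ∉ H) → ∀ᶠ i in l, ∀ g ∈ K, g ∉ F i)
    (hU : ∀ U : Set G, IsOpen U → (∃ g ∈ U, g ∈ H) → ∀ᶠ i in l, ∃ g ∈ U, g ∈ F i) :
    Tendsto F l (𝓝 H) := by
  let _ := chabautyTopology G
  rw [nhds_induced, tendsto_comap_iff, tendsto_nhds_generateFrom_iff]
  rintro _ (⟨K, hKc, rfl⟩ | ⟨U, hUo, rfl⟩) h
  · refine (hK K hKc fun g hg hgH => ?_).mono fun i hi => ?_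
    · exact eq_empty_iff_forall_notMem.1 h g ⟨hgH, hg⟩
    · exact eq_empty_iff_forall_notMem.2 fun g hg => hi g hg.2 hg.1
  · obtain ⟨g, hgH, hg⟩ := h
    exact (hU U hUo ⟨g, hg, hgH⟩).mono fun i ⟨a, ha, haF⟩ => ⟨a, haF, ha⟩

theorem ClosedSubgroup.isOpen_setOf_forall_notMem {K : Set G} (hK : IsCompact K) :
    IsOpen {H : ClosedSubgroup G | ∀ g ∈ K, g ∉ H} := by
  let _ := chabautyTopology G
  have h : IsOpen {F : Closeds G | (F : Set G) ∩ K = ∅} :=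
    isOpen_generateFrom_of_mem (.inl ⟨K, hK, rfl⟩)
  refine isOpen_induced_iff.2 ⟨_, h, ext fun H => ⟨fun h => ?_, fun h => ?_⟩⟩
  · exact fun g hg hgH => eq_empty_iff_forall_notMem.1 h g ⟨hgH, hg⟩
  · exact eq_empty_iff_forall_notMem.2 fun g hg => h g hg.2 hg.1

theorem ClosedSubgroup.isOpen_setOf_exists_mem {U : Set G} (hU : IsOpen U) :
    IsOpen {H : ClosedSubgroup G | ∃ g ∈ U, g ∈ H} := by
  let _ := chabautyTopology G
  have h : IsOpen {F : Closeds G | ((F : Set G) ∩ U).Nonempty} :=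
    isOpen_generateFrom_of_mem (.inr ⟨U, hU, rfl⟩)
  exact isOpen_induced_iff.2 ⟨_, h, ext fun H =>
    ⟨fun ⟨g, hgH, hg⟩ => ⟨g, hg, hgH⟩, fun ⟨g, hg, hgH⟩ => ⟨g, hgH, hg⟩⟩⟩

/-- If `g` lies in `H` but not in `H'`, a compact neighbourhood of `g` missing `H'` separates them:
meeting its interior and avoiding it are disjoint open conditions. -/
instance ClosedSubgroup.t2Space [LocallyCompactSpace G] : T2Space (ClosedSubgroup G) := by
  have key : ∀ H H' : ClosedSubgroup G, ∀ g ∈ H, g ∉ H' → ∃ 𝒰 𝒱 : Set (ClosedSubgroup G),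
      IsOpen 𝒰 ∧ IsOpen 𝒱 ∧ H ∈ 𝒰 ∧ H' ∈ 𝒱 ∧ Disjoint 𝒰 𝒱 := by
    intro H H' g hg hg'
    obtain ⟨K, hK, hKH, hKc⟩ := local_compact_nhds (H'.isClosed'.isOpen_compl.mem_nhds hg')
    refine ⟨_, _, isOpen_setOf_exists_mem isOpen_interior, isOpen_setOf_forall_notMem hKc,
      ⟨g, mem_interior_iff_mem_nhds.2 hK, hg⟩, fun a ha => hKH ha, ?_⟩
    exact disjoint_left.2 fun F ⟨a, ha, haF⟩ h => h a (interior_subset ha) haF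
  refine ⟨fun H H' hne => ?_⟩
  by_cases h : ∃ g ∈ H, g ∉ H'
  · obtain ⟨g, hg, hg'⟩ := h
    exact key H H' g hg hg'
  · push Not at h
    obtain ⟨g, hg, hg'⟩ : ∃ g ∈ H', g ∉ H := by
      by_contra! h'
      exact hne (SetLike.ext fun g => ⟨h g, h' g⟩)
    obtain ⟨𝒰, 𝒱, h1, h2, h3, h4, h5⟩ := key H' H g hg hg'
    exact ⟨𝒱, 𝒰, h2, h1, h4, h3, h5.symm⟩

end Chabauty

/-! ### Stabilizers in the universal extension and in its base -/

section Stabilizer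

open Filter

theorem eventually_forall_notMem_stabilizerMap {G : Type v} {X : Type u}
    [Group G] [TopologicalSpace G] [TopologicalSpace X] [T2Space X] [MulAction G X]
    [ContinuousSMul G X] {x : X} {K : Set G} (hK : IsCompact K)
    (hx : ∀ g ∈ K, g ∉ stabilizerMap G X x) :
    ∀ᶠ y in 𝓝 x, ∀ g ∈ K, g ∉ stabilizerMap G X y := by
  have h := (isClosed_setOf_exists_smul_eq (Z := X) hK 1).isOpen_compl
  refine mem_of_superset (h.mem_nhds (x := x) fun ⟨k, hk, e⟩ => hx k hk (e.trans (one_smul G x))) ?_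
  exact fun y hy g hg e => hy ⟨g, hg, Eq.trans e (one_smul G y).symm⟩

variable {G : Type v} [Group G] [TopologicalSpace G] [IsTopologicalGroup G]
  [LocallyCompactSpace G] {Z X : Type u} [TopologicalSpace X] [MulAction G X]
  [TopologicalSpace Z] [CompactSpace Z] [T2Space Z] [MulAction G Z] [ContinuousSMul G Z] {π : Z → X}

namespace IsUniversalIrreducibleExtension

theorem eventually_exists_mem_stabilizerMap (hπ : IsUniversalIrreducibleExtension G π) {z : Z}
    {U : Set G} (hU : IsOpen U) (hz : ∃ g ∈ U, g ∈ stabilizerMap G Z z) :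
    ∀ᶠ y in 𝓝 z, ∃ g ∈ U, g ∈ stabilizerMap G Z y := by
  obtain ⟨g, hg, hgz⟩ := hz
  have hV : (fun v => v * g) ⁻¹' U ∈ 𝓝 (1 : G) :=
    (continuous_mul_const g).continuousAt.preimage_mem_nhds (hU.mem_nhds (by simpa using hg))
  exact (hπ.eventually_exists_mul_smul_eq hgz hV).mono fun y ⟨v, hv, e⟩ => ⟨v * g, hv, e⟩

/-- The stabilizer map of the universal irreducible extension is continuous. -/
theorem continuous_stabilizerMap (hπ : IsUniversalIrreducibleExtension G π) :
    Continuous (stabilizerMap G Z) :=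
  continuous_iff_continuousAt.2 fun _ => ClosedSubgroup.tendsto_nhds
    (fun _ hK => eventually_forall_notMem_stabilizerMap hK)
    (fun _ hU => hπ.eventually_exists_mem_stabilizerMap hU)

theorem isClosed_stabilizerFlow (hπ : IsUniversalIrreducibleExtension G π) :
    IsClosed (stabilizerFlow hπ) :=
  (isCompact_range hπ.continuous_stabilizerMap).isClosed

variable [T2Space X] [ContinuousSMul G X]

/-- Generically near `z`, the stabilizers of the images in `X` are close to the stabilizer
of `z`. -/
theorem tendsto_stabilizerMap_comp (hπ : IsUniversalIrreducibleExtension G π) (z : Z) :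
    Tendsto (fun y => stabilizerMap G X (π y)) (𝓝 z ⊓ genericFilter Z)
      (𝓝 (stabilizerMap G Z z)) := by
  refine ClosedSubgroup.tendsto_nhds (fun K hK hz => ?_) fun U hU hz => ?_
  -- Generically, an element of `K` fixing `π y` forces some element of `K` to fix `y`, which is
  -- excluded near `z`.
  · have hD := (hπ.isNowhereDense_returns hK).compl_mem_genericFilter
    filter_upwards [mem_inf_of_left (eventually_forall_notMem_stabilizerMap hK hz),
      mem_inf_of_right hD] with y hy hyD k hk e
    exact hyD ⟨fun ⟨k', hk', e'⟩ => hy k' hk' e', k, hk, e⟩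
  -- This half needs no genericity: what fixes `y` fixes `π y`.
  · filter_upwards [mem_inf_of_left (hπ.eventually_exists_mem_stabilizerMap hU hz)]
      with y ⟨g, hg, e⟩
    exact ⟨g, hg, (hπ.map_smul g y).symm.trans (congrArg π e)⟩

theorem stabilizerFlow_subset_closure (hπ : IsUniversalIrreducibleExtension G π) {X' : Set X}
    (hX' : Dense X') : stabilizerFlow hπ ⊆ closure (stabilizerMap G X '' X') := by
  rintro _ ⟨z, rfl⟩
  refine mem_closure_of_frequently_of_tendsto
    (((hπ.frequently_genericFilter hX' z).mono fun y hy => ⟨π y, hy, rfl⟩))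
    (hπ.tendsto_stabilizerMap_comp z)

/-- For any `z` over `x`, the stabilizers of `π y` along generic `y → z` tend both to that of `z`
and, by continuity at `x`, to that of `x`. -/
theorem stabilizerMap_mem_stabilizerFlow (hπ : IsUniversalIrreducibleExtension G π) {x : X}
    (hx : ContinuousAt (stabilizerMap G X) x) : stabilizerMap G X x ∈ stabilizerFlow hπ := by
  obtain ⟨z, rfl⟩ := hπ.surjective x
  refine ⟨z, tendsto_nhds_unique (hπ.tendsto_stabilizerMap_comp z) ?_⟩
  exact (hx.tendsto.comp (hπ.continuous.tendsto z)).mono_left inf_le_left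

end IsUniversalIrreducibleExtension

end Stabilizer

theorem proposition5p2 {G : Type v} [Group G] [TopologicalSpace G] [IsTopologicalGroup G]
    [LocallyCompactSpace G] [T2Space G]
    {X : Type u} [TopologicalSpace X] [CompactSpace X] [T2Space X] [MulAction G X]
    [ContinuousSMul G X]
    {Z : Type u} [TopologicalSpace Z] [CompactSpace Z] [T2Space Z] [MulAction G Z]
    [ContinuousSMul G Z]
    (π : Z → X) (hπ : IsUniversalIrreducibleExtension G π) :
    (∀ K : Set G, IsCompact K →
      IsNowhereDense {z : Z | z ∉ (fun k : G => k • z) '' K ∧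
        π z ∈ (fun k : G => k • π z) '' K}) ∧
    (∀ X' : Set X, Dense X' → stabilizerFlow hπ ⊆ closure (stabilizerMap G X '' X')) ∧
    (∀ x : X, ContinuousAt (stabilizerMap G X) x → stabilizerMap G X x ∈ stabilizerFlow hπ) ∧
    (Dense {x : X | ContinuousAt (stabilizerMap G X) x} →
      stabilizerFlow hπ =
        closure (stabilizerMap G X '' {x : X | ContinuousAt (stabilizerMap G X) x})) := by
  refine ⟨fun K => hπ.isNowhereDense_returns, fun X' => hπ.stabilizerFlow_subset_closure,
    fun x => hπ.stabilizerMap_mem_stabilizerFlow, fun hd => ?_⟩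
  refine (hπ.stabilizerFlow_subset_closure hd).antisymm
    (closure_minimal ?_ hπ.isClosed_stabilizerFlow)
  rintro _ ⟨x, hx, rfl⟩
  exact hπ.stabilizerMap_mem_stabilizerFlow hx
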